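/- **Setting.** A $(K,K_{\rm u},N)$ cache-aided multiuser PIR scheme consists of: $K$ independent messages $W_1,\dots,W_K$, each uniform on $\{0,1\}^L$ for some $L\ge 1$; caches $Z_1,\dots,Z_{K_{\rm u}}$ of at most $ML$ bits each, which are functions of the library (\emph{uncoded} prefetching: every cached bit is a copy of a library bit at a fixed position); queries $Q_1^{[\theta]},\dots,Q_N^{[\theta]}$, generated by the users from the placement, the demand vector $\theta\in[K]^{K_{\rm u}}$ and randomness independent of the messages (all alphabets finite); and answers $A_n^{[\theta]}$ that are deterministic functions of $Q_n^{[\theta]}$ and $W_{1:K}$. It must satisfy $H(W_{\theta_u}\mid Q^{[\theta]}_{1:N},A^{[\theta]}_{1:N},Z_u)=0$ for all $\theta$ and all users $u$, and $I(\theta;Q_n^{[\theta]},A_n^{[\theta]},W_{1:K},Z_{1:K_{\rm u}})=0$ for each database $n$ and every distribution of $\theta$ (independent of the messages and of the users' randomness). Its load is $R=\sum_{n=1}^N H(A_n^{[\theta]})/L$ (in bits, for every $\theta$). The pair $(M,R)$ is achievable if some such scheme has cache size at most $ML$ and load $R$. Let $K=2$, $K_{\rm u}\ge 2$, $N\ge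 2$. For $1\le t\le K_{\rm u}-1$ put $$M_t=\frac{2\binom{K_{\rm u}-1}{t-1}(N-1)}{\binom{K_{\rm u}}{t}(N-1)+\binom{K_{\rm u}}{t+1}},\qquad R_t=\min\left\{\frac{\binom{K_{\rm u}}{t+1}(N+1)}{\binom{K_{\rm u}}{t}(N-1)+\binom{K_{\rm u}}{t+1}},\,2-M_t\right\},$$ and let $R(M)$, $0\le M\le 2$, be the lower convex envelope of the points $(M_t,R_t)$, $1\le t\le K_{\rm u}-1$, $(0,2)$ and $(2,0)$. **Corollary (optimality in the large memory regime).** We have $M_{K_{\rm u}-1}=\frac{2(K_{\rm u}-1)(N-1)}{K_{\rm u}(N-1)+1}$ and $R_{K_{\rm u}-1}=\frac{N+1}{K_{\rm u}(N-1)+1}$. For every real $M$ with $M_{K_{\rm u}-1}\le M\le 2$: 1. $R(M)=\left(1-\frac M2\right)\left(1+\frac1N\right)$, the single-user cache-aided PIR bound, and $(M,R(M))$ lies on the segment joining $(M_{K_{\rm u}-1},R_{K_{\rm u}-1})$ and $(2,0)$ (memory sharing); 2. $R(M)$ is optimal: it is the infimum of the loads achievable at memory size $M$ with uncoded prefetching,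 and also the infimum of the loads achievable at memory size $M$ with arbitrary (possibly coded) prefetching. If $M$ is rational, the load $R(M)$ is attained by a single scheme with uncoded prefetching. -/

import Mathlib

/-! Shannon information measures (in bits) of random variables with finite alphabets. -/

/-- Shannon entropy `H(X)` in bits of `X : Ω → α` under the law `p` on `Ω`. -/
noncomputable def shannonEntropy {Ω α : Type*} [Fintype α] (p : PMF Ω) (X : Ω → α) : ℝ :=
  ∑ a, Real.negMulLog ((p.map X) a).toReal / Real.log 2

/-- Conditional entropy `H(X | Y) = H(X, Y) - H(Y)`. -/
noncomputable def condEntropy {Ω α β : Type*} [Fintype α] [Fintype β]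
    (p : PMF Ω) (X : Ω → α) (Y : Ω → β) : ℝ :=
  shannonEntropy p (fun ω => (X ω, Y ω)) - shannonEntropy p Y

/-- Mutual information `I(X; Y) = H(X) + H(Y) - H(X, Y)`. -/
noncomputable def mutualInfo {Ω α β : Type*} [Fintype α] [Fintype β]
    (p : PMF Ω) (X : Ω → α) (Y : Ω → β) : ℝ :=
  shannonEntropy p X + shannonEntropy p Y - shannonEntropy p (fun ω => (X ω, Y ω))

/-- The law of an independent pair. -/
noncomputable def indepPair {α β : Type*} (p : PMF α) (q : PMF β) : PMF (α × β) :=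
  p.bind fun a => q.map fun b => (a, b)

/-- A library of `K` messages of `L` bits each. -/
abbrev Library (K L : ℕ) : Type := Fin K → Fin L → Bool

/-- A demand vector: user `u` wants the message with index `θ u`. -/
abbrev Demand (K Ku : ℕ) : Type := Fin Ku → Fin K

/-- A placement-and-delivery scheme for `K` messages, `Ku` users and `N` databases.
The placement is made without knowledge of the demands. In the delivery phase the users jointly
draw a random seed, which is independent of the messages; the queries are determined by the demand
vector and the seed (for a given placement), and each answer is determined by the query received
by the database and by the library. Caches may be arbitrary functions of the library; uncoded
prefetching is the predicate `MuPIRScheme.IsUncoded`. -/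
structure MuPIRScheme (K Ku N : ℕ) where
  /-- number of bits of a message -/
  L : ℕ
  L_pos : 0 < L
  /-- number of bits cached by each user -/
  cacheBits : Fin Ku → ℕ
  /-- the cached bits -/
  cache : ∀ u : Fin Ku, Library K L → (Fin (cacheBits u) → Bool)
  /-- the users' randomness -/
  Seed : Type
  seedLaw : PMF Seed
  /-- alphabet of the queries -/
  Query : Type
  queryFintype : Fintype Query
  /-- alphabet of the answers -/
  Answer : Type
  answerFintype : Fintype Answer
  query : Demand K Ku → Seed → Fin N → Query
  answer : Fin N → Query → Library K L → Answer

attribute [instance] MuPIRScheme.queryFintype MuPIRScheme.answerFintype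

namespace MuPIRScheme

variable {K Ku N : ℕ} (S : MuPIRScheme K Ku N)

/-- Sample space, for a fixed demand vector: the library and the users' randomness. -/
abbrev Sample : Type := Library K S.L × S.Seed

/-- Uniformly distributed independent messages, independent of the users' randomness. -/
noncomputable def law : PMF S.Sample :=
  indepPair (PMF.uniformOfFintype (Library K S.L)) S.seedLaw

/-- The query sent to database `n` under the demand vector `θ`. -/
def Q (θ : Demand K Ku) (n : Fin N) (ω : S.Sample) : S.Query := S.query θ ω.2 n

/-- The answer of database `n` under the demand vector `θ`. -/
def A (θ : Demand K Ku) (n : Fin N) (ω : S.Sample) : S.Answer :=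
  S.answer n (S.Q θ n ω) ω.1

/-- The cache of user `u`. -/
def Z (u : Fin Ku) (ω : S.Sample) : Fin (S.cacheBits u) → Bool := S.cache u ω.1

/-- Decodability: `H(W_{θ_u} | Q_{1:N}, A_{1:N}, Z_u) = 0` for all demand vectors and users. -/
def Decodable : Prop :=
  ∀ (θ : Demand K Ku) (u : Fin Ku),
    condEntropy S.law (fun ω => ω.1 (θ u))
      (fun ω => ((fun n => S.Q θ n ω), (fun n => S.A θ n ω), S.Z u ω)) = 0

/-- Demand privacy: whatever the distribution of the demand vector `θ` (independent of the messages
and of the users' randomness), `I(θ; Q_n, A_n, W_{1:K}, Z_{1:Ku}) = 0` for each database `n`. -/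
def Private : Prop :=
  ∀ (prior : PMF (Demand K Ku)) (n : Fin N),
    mutualInfo (indepPair prior S.law) (fun x => x.1)
      (fun x => (S.Q x.1 n x.2, S.A x.1 n x.2, x.2.1, fun u => S.Z u x.2)) = 0

/-- The load: total entropy of the answers, normalized by the message length. -/
noncomputable def load (θ : Demand K Ku) : ℝ :=
  (∑ n, shannonEntropy S.law (S.A θ n)) / S.L

/-- Uncoded prefetching: each cached bit is a copy of some bit of the library, at a fixed place. -/
def IsUncoded : Prop :=
  ∀ u, ∃ pos : Fin (S.cacheBits u) → Fin K × Fin S.L,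
    ∀ (W : Library K S.L) (j : Fin (S.cacheBits u)), S.cache u W j = W (pos j).1 (pos j).2

/-- The scheme is decodable and private, uses caches of at most `M * L` bits, and has load `R`. -/
def Attains (M R : ℝ) : Prop :=
  S.Decodable ∧ S.Private ∧ (∀ u, (S.cacheBits u : ℝ) ≤ M * S.L) ∧ ∀ θ, S.load θ = R

end MuPIRScheme

/-- `(M, R)` is achieved by some scheme, with arbitrary (possibly coded) prefetching. -/
def Achievable (K Ku N : ℕ) (M R : ℝ) : Prop :=
  ∃ S : MuPIRScheme K Ku N, S.Attains M R

/-- `(M, R)` is achieved by some scheme with uncoded prefetching. -/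
def UncodedAchievable (K Ku N : ℕ) (M R : ℝ) : Prop :=
  ∃ S : MuPIRScheme K Ku N, S.IsUncoded ∧ S.Attains M R

/-- The memory sizes `M_t` of the proposed scheme (`K = 2`, `1 ≤ t ≤ Ku - 1`). -/
noncomputable def memPoint (Ku N t : ℕ) : ℝ :=
  2 * (Ku - 1).choose (t - 1) * ((N : ℝ) - 1) /
    (Ku.choose t * ((N : ℝ) - 1) + Ku.choose (t + 1))

/-- The loads `R_t` of the proposed scheme (`K = 2`, `1 ≤ t ≤ Ku - 1`). -/
noncomputable def loadPoint (Ku N t : ℕ) : ℝ :=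
  min (Ku.choose (t + 1) * ((N : ℝ) + 1) /
      (Ku.choose t * ((N : ℝ) - 1) + Ku.choose (t + 1)))
    (2 - memPoint Ku N t)

/-- The corner points `(M_t, R_t)`, `1 ≤ t ≤ Ku - 1`, together with `(0, 2)` and `(2, 0)`. -/
noncomputable def cornerPoints (Ku N : ℕ) : Set (ℝ × ℝ) :=
  {p | ∃ t : ℕ, 1 ≤ t ∧ t ≤ Ku - 1 ∧ p = (memPoint Ku N t, loadPoint Ku N t)} ∪ {(0, 2), (2, 0)}

/-- The load of the proposed scheme for `0 ≤ M ≤ 2`: the lower convex envelope of the corner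
points, i.e. the lower boundary of their convex hull. -/
noncomputable def proposedLoad (Ku N : ℕ) (M : ℝ) : ℝ :=
  sInf {r : ℝ | (M, r) ∈ convexHull ℝ (cornerPoints Ku N)}

/-! ### Entropy of finite random variables -/

/-! Both the converse and the scheme meet the line R = (1 - M/2)(1 + 1/N).

Converse (`converse_step`, `Achievable.le_load`). One user u suffices. Let D be the total entropy of
the answers under θ. Decodability gives D ≥ H(W_θ | Z) + H(A^θ | Q, Z, W_θ). The last term, the
interference, is at least H(A_n^θ | Q_n, Z, W_θ) for each n. By privacy this value is unchanged when
θ is replaced by θ'. Summing over n and decoding W_θ' from the answers to θ' yields N·D ≥ N·H(W_θ |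
Z) + H(W_θ' | Z, W_θ). Adding the two choices of (W_θ, W_θ') and using submodularity, 2L + H(Z) ≤
H(W_0, Z) + H(W_1, Z), gives 2N·D ≥ (N + 1)(2L - H(Z)). Coded caches are covered.

Scheme (`blockScheme`, with d = N - 1). A block holds d bits per user, missing only from that user's
cache, and one bit cached by nobody. Database 0 returns a random combination of each message;
database j + 1 returns the sum of the two combinations with one coefficient flipped per user. The
difference is a coded multicast of one desired bit per user, and each user cancels the other terms
from its cache. The answers have m(d + 2) bits for m blocks. The s bits cached by everyone build
memory sharing with (2, 0) into one scheme.

Envelope. All corner points lie on or above the line, while (2, 0) and the point with t = Ku - 1 lie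
on it. Rational M is attained exactly; other M are approximated from below. -/

section Entropy

variable {Ω α β γ δ : Type*}

/-- The probability of `X = a`, as a real number. -/
noncomputable def probOf (p : PMF Ω) (X : Ω → α) (a : α) : ℝ := ((p.map X) a).toReal

theorem probOf_nonneg (p : PMF Ω) (X : Ω → α) (a : α) : 0 ≤ probOf p X a :=
  ENNReal.toReal_nonneg

theorem sum_probOf [Fintype α] (p : PMF Ω) (X : Ω → α) : ∑ a, probOf p X a = 1 := by
  unfold probOf
  rw [← ENNReal.toReal_sum fun a _ => PMF.apply_ne_top _ a, ← tsum_fintype (L := .unconditional _),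
    PMF.tsum_coe, ENNReal.toReal_one]

open Classical in
theorem probOf_comp [Fintype α] (p : PMF Ω) (X : Ω → α) (f : α → β) (b : β) :
    probOf p (fun ω => f (X ω)) b = ∑ a, if f a = b then probOf p X a else 0 := by
  have h : p.map (fun ω => f (X ω)) = (p.map X).map f := (PMF.map_comp X p f).symm
  unfold probOf
  rw [h, PMF.map_apply, tsum_fintype, ENNReal.toReal_sum]
  · refine Finset.sum_congr rfl fun a _ => ?_
    by_cases hb : f a = b
    · simp [hb]
    · simp [hb, Ne.symm hb]
  · intro a _
    split_ifs
    · exact PMF.apply_ne_top _ a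
    · exact ENNReal.zero_ne_top

theorem sum_probOf_comp_mul [Fintype α] [Fintype β] (p : PMF Ω) (X : Ω → α) (f : α → β)
    (g : β → ℝ) :
    ∑ b, probOf p (fun ω => f (X ω)) b * g b = ∑ a, probOf p X a * g (f a) := by
  classical
  simp_rw [probOf_comp p X f, Finset.sum_mul]
  rw [Finset.sum_comm]
  refine Finset.sum_congr rfl fun a _ => ?_
  simp [ite_mul]

theorem probOf_le_comp [Fintype α] (p : PMF Ω) (X : Ω → α) (f : α → β) (a : α) :
    probOf p X a ≤ probOf p (fun ω => f (X ω)) (f a) := by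
  classical
  rw [probOf_comp p X f]
  refine le_trans ?_ (Finset.single_le_sum (f := fun x => if f x = f a then probOf p X x else 0)
    (fun i _ => ?_) (Finset.mem_univ a))
  · simp
  · split_ifs
    exacts [probOf_nonneg _ _ _, le_rfl]

theorem sum_probOf_fst [Fintype α] [Fintype β] (p : PMF Ω) (X : Ω → α) (Y : Ω → β) (b : β) :
    ∑ a, probOf p (fun ω => (X ω, Y ω)) (a, b) = probOf p Y b := by
  classical
  have := probOf_comp p (fun ω => (X ω, Y ω)) Prod.snd b
  dsimp only at this
  rw [this, Fintype.sum_prod_type]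
  simp

theorem shannonEntropy_eq_sum [Fintype α] (p : PMF Ω) (X : Ω → α) :
    shannonEntropy p X = -(∑ a, probOf p X a * Real.log (probOf p X a)) / Real.log 2 := by
  unfold shannonEntropy probOf
  rw [← Finset.sum_div]
  simp [Real.negMulLog]

/-- Writes entropies of marginals as sums over the alphabet of the joint variable, so that they can
be compared termwise. -/
theorem shannonEntropy_comp [Fintype α] [Fintype β] (p : PMF Ω) (X : Ω → α) (f : α → β) :
    shannonEntropy p (fun ω => f (X ω)) =
      -(∑ a, probOf p X a * Real.log (probOf p (fun ω => f (X ω)) (f a))) / Real.log 2 := by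
  rw [shannonEntropy_eq_sum,
    sum_probOf_comp_mul p X f fun b => Real.log (probOf p (fun ω => f (X ω)) b)]

theorem log_two_pos' : 0 < Real.log 2 := Real.log_pos one_lt_two

theorem shannonEntropy_comp_le [Fintype α] [Fintype β] (p : PMF Ω) (X : Ω → α) (f : α → β) :
    shannonEntropy p (fun ω => f (X ω)) ≤ shannonEntropy p X := by
  rw [shannonEntropy_comp, shannonEntropy_eq_sum]
  refine div_le_div_of_nonneg_right (neg_le_neg (Finset.sum_le_sum fun a _ => ?_))
    log_two_pos'.le
  rcases (probOf_nonneg p X a).eq_or_lt with h | h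
  · simp [← h]
  · exact mul_le_mul_of_nonneg_left (Real.log_le_log h (probOf_le_comp p X f a)) h.le

theorem shannonEntropy_le_of_factorsThrough [Fintype α] [Fintype β] (p : PMF Ω) {X : Ω → α}
    {Y : Ω → β} (h : Function.FactorsThrough X Y) : shannonEntropy p X ≤ shannonEntropy p Y := by
  obtain ⟨ω, -⟩ := p.support_nonempty
  have : Nonempty α := ⟨X ω⟩
  obtain ⟨f, rfl⟩ := (Function.factorsThrough_iff X).1 h
  exact shannonEntropy_comp_le p Y f

/-- Entropy depends only on the fibres of a variable; this serves to reorder tuples and to drop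
redundant entries. -/
theorem shannonEntropy_congr [Fintype α] [Fintype β] (p : PMF Ω) {X : Ω → α} {Y : Ω → β}
    (h : ∀ ω ω', X ω = X ω' ↔ Y ω = Y ω') : shannonEntropy p X = shannonEntropy p Y :=
  le_antisymm (shannonEntropy_le_of_factorsThrough p fun ω ω' e => (h ω ω').2 e)
    (shannonEntropy_le_of_factorsThrough p fun ω ω' e => (h ω ω').1 e)

/-- Termwise form of Gibbs' inequality. -/
theorem mul_log_sub_log_le {a b : ℝ} (ha : 0 ≤ a) (hb : 0 ≤ b) (h : b = 0 → a = 0) :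
    a * (Real.log b - Real.log a) ≤ b - a := by
  rcases ha.eq_or_lt with rfl | ha
  · simpa using hb
  · have hb' : 0 < b := hb.lt_of_ne fun e => ha.ne' (h e.symm)
    rw [← Real.log_div hb'.ne' ha.ne']
    calc a * Real.log (b / a) ≤ a * (b / a - 1) :=
          mul_le_mul_of_nonneg_left (Real.log_le_sub_one_of_pos (by positivity)) ha.le
      _ = b - a := by field_simp

theorem eq_of_mul_log_sub_log_eq {a b : ℝ} (ha : 0 ≤ a) (hb : 0 ≤ b) (h : b = 0 → a = 0)
    (e : a * (Real.log b - Real.log a) = b - a) : a = b := by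
  rcases ha.eq_or_lt with rfl | ha
  · simpa using e
  · have hb' : 0 < b := hb.lt_of_ne fun e => ha.ne' (h e.symm)
    by_contra hne
    have h1 : b / a ≠ 1 := fun h2 => hne ((div_eq_one_iff_eq ha.ne').1 h2).symm
    have h2 := mul_lt_mul_of_pos_left (Real.log_lt_sub_one_of_pos (by positivity) h1) ha
    rw [Real.log_div hb'.ne' ha.ne', e] at h2
    have : a * (b / a - 1) = b - a := by field_simp
    linarith

/-- Absolute continuity `h` matters: with the convention `Real.log 0 = 0` the inequality would fail
without it. -/
theorem gibbs_inequality [Fintype α] {P q : α → ℝ} (hP : ∀ a, 0 ≤ P a) (hq : ∀ a, 0 ≤ q a)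
    (h : ∀ a, q a = 0 → P a = 0) (hs : ∑ a, q a ≤ ∑ a, P a) :
    ∑ a, P a * (Real.log (q a) - Real.log (P a)) ≤ 0 :=
  calc _ ≤ ∑ a, (q a - P a) :=
        Finset.sum_le_sum fun a _ => mul_log_sub_log_le (hP a) (hq a) (h a)
    _ ≤ 0 := by rw [Finset.sum_sub_distrib]; linarith

theorem eq_of_gibbs_equality [Fintype α] {P q : α → ℝ} (hP : ∀ a, 0 ≤ P a) (hq : ∀ a, 0 ≤ q a)
    (h : ∀ a, q a = 0 → P a = 0) (hs : ∑ a, q a ≤ ∑ a, P a)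
    (e : ∑ a, P a * (Real.log (q a) - Real.log (P a)) = 0) (a : α) : P a = q a := by
  have hle := fun a (_ : a ∈ Finset.univ) => mul_log_sub_log_le (hP a) (hq a) (h a)
  have h1 : ∑ a, (q a - P a) ≤ 0 := by rw [Finset.sum_sub_distrib]; linarith
  have h2 := (Finset.sum_eq_sum_iff_of_le hle).1
    (le_antisymm (Finset.sum_le_sum hle) (h1.trans_eq e.symm))
  exact eq_of_mul_log_sub_log_eq (hP a) (hq a) (h a) (h2 a (Finset.mem_univ a))

theorem probOf_eq_zero_of_comp [Fintype α] {p : PMF Ω} {X : Ω → α} (f : α → β) {a : α}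
    (h : probOf p (fun ω => f (X ω)) (f a) = 0) : probOf p X a = 0 :=
  le_antisymm ((probOf_le_comp p X f a).trans_eq h) (probOf_nonneg p X a)

/-- Strong subadditivity of entropy. -/
theorem shannonEntropy_submodular [Fintype α] [Fintype β] [Fintype γ] (p : PMF Ω)
    (X : Ω → α) (Y : Ω → β) (Z : Ω → γ) :
    shannonEntropy p (fun ω => (X ω, Y ω, Z ω)) + shannonEntropy p Z ≤
      shannonEntropy p (fun ω => (X ω, Z ω)) + shannonEntropy p (fun ω => (Y ω, Z ω)) := by
  set V : Ω → α × β × γ := fun ω => (X ω, Y ω, Z ω)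
  have hXZ := shannonEntropy_comp p V fun v => (v.1, v.2.2)
  have hYZ := shannonEntropy_comp p V fun v => v.2
  have hZ := shannonEntropy_comp p V fun v => v.2.2
  have hV := shannonEntropy_eq_sum p V
  have zXZ : ∀ v, probOf p (fun ω => (X ω, Z ω)) (v.1, v.2.2) = 0 → probOf p V v = 0 :=
    fun v => probOf_eq_zero_of_comp (X := V) fun v => (v.1, v.2.2)
  have zYZ : ∀ v, probOf p (fun ω => (Y ω, Z ω)) v.2 = 0 → probOf p V v = 0 :=
    fun v => probOf_eq_zero_of_comp (X := V) fun v => v.2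
  have zZ : ∀ v, probOf p Z v.2.2 = 0 → probOf p V v = 0 :=
    fun v => probOf_eq_zero_of_comp (X := V) fun v => v.2.2
  dsimp only [V] at hXZ hYZ hZ
  change _ = -(∑ a, probOf p V a * _) / _ at hXZ
  change _ = -(∑ a, probOf p V a * _) / _ at hYZ
  change _ = -(∑ a, probOf p V a * _) / _ at hZ
  rw [hV, hZ, hXZ, hYZ, ← add_div, ← add_div]
  refine div_le_div_of_nonneg_right ?_ log_two_pos'.le
  -- The comparison law P(x,z) P(y,z) / P(z) makes X and Y conditionally independent given Z.
  have key := gibbs_inequality (P := probOf p V)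
    (q := fun v => probOf p (fun ω => (X ω, Z ω)) (v.1, v.2.2) * probOf p (fun ω => (Y ω, Z ω)) v.2
      / probOf p Z v.2.2) (probOf_nonneg p V)
    (fun v => div_nonneg (mul_nonneg (probOf_nonneg _ _ _) (probOf_nonneg _ _ _))
      (probOf_nonneg _ _ _))
    (fun v hv => by
      rcases div_eq_zero_iff.1 hv with h | h
      · rcases mul_eq_zero.1 h with h | h
        exacts [zXZ v h, zYZ v h]
      · exact zZ v h)
    (by
      rw [sum_probOf p V, Fintype.sum_prod_type]
      simp_rw [Fintype.sum_prod_type]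
      rw [Finset.sum_comm]
      have : ∀ b : β, ∑ a : α, ∑ c : γ, probOf p (fun ω => (X ω, Z ω)) (a, c) *
          probOf p (fun ω => (Y ω, Z ω)) (b, c) / probOf p Z c
          = ∑ c : γ, probOf p (fun ω => (Y ω, Z ω)) (b, c) := fun b => by
        rw [Finset.sum_comm]
        refine Finset.sum_congr rfl fun c _ => ?_
        rw [← Finset.sum_div, ← Finset.sum_mul, sum_probOf_fst]
        rcases eq_or_ne (probOf p Z c) 0 with h | h
        · have : probOf p (fun ω => (Y ω, Z ω)) (b, c) = 0 :=
            probOf_eq_zero_of_comp (X := fun ω => (Y ω, Z ω)) Prod.snd h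
          simp [this]
        · field_simp
      simp_rw [this]
      rw [← Fintype.sum_prod_type (f := probOf p fun ω => (Y ω, Z ω)), sum_probOf])
  have e : ∀ v, probOf p V v * (Real.log (probOf p (fun ω => (X ω, Z ω)) (v.1, v.2.2) *
      probOf p (fun ω => (Y ω, Z ω)) v.2 / probOf p Z v.2.2) - Real.log (probOf p V v)) =
      probOf p V v * Real.log (probOf p (fun ω => (X ω, Z ω)) (v.1, v.2.2)) +
      probOf p V v * Real.log (probOf p (fun ω => (Y ω, Z ω)) v.2) -
      probOf p V v * Real.log (probOf p Z v.2.2) - probOf p V v * Real.log (probOf p V v) := by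
    intro v
    rcases eq_or_ne (probOf p V v) 0 with h | h
    · simp [h]
    · rw [Real.log_div (mul_ne_zero (mt (zXZ v) h) (mt (zYZ v) h)) (mt (zZ v) h),
        Real.log_mul (mt (zXZ v) h) (mt (zYZ v) h)]
      ring
  simp_rw [e, Finset.sum_sub_distrib, Finset.sum_add_distrib] at key
  linarith

/-- Mutual information is the relative entropy of the joint law with respect to the product of the
marginals, so the equality case of Gibbs' inequality detects independence. -/
theorem mutualInfo_eq_sum [Fintype α] [Fintype β] (p : PMF Ω) (X : Ω → α) (Y : Ω → β) :
    mutualInfo p X Y = -(∑ v, probOf p (fun ω => (X ω, Y ω)) v *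
      (Real.log (probOf p X v.1 * probOf p Y v.2) -
        Real.log (probOf p (fun ω => (X ω, Y ω)) v))) / Real.log 2 := by
  have hX := shannonEntropy_comp p (fun ω => (X ω, Y ω)) Prod.fst
  have hY := shannonEntropy_comp p (fun ω => (X ω, Y ω)) Prod.snd
  dsimp only at hX hY
  unfold mutualInfo
  rw [hX, hY, shannonEntropy_eq_sum, ← add_div, ← sub_div]
  congr 1
  rw [← neg_add, neg_sub_neg, ← Finset.sum_add_distrib, ← Finset.sum_sub_distrib,
    ← Finset.sum_neg_distrib]
  refine Finset.sum_congr rfl fun v _ => ?_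
  rcases eq_or_ne (probOf p (fun ω => (X ω, Y ω)) v) 0 with h | h
  · simp [h]
  · have h1 : probOf p X v.1 ≠ 0 := mt (probOf_eq_zero_of_comp (X := fun ω => (X ω, Y ω)) Prod.fst) h
    have h2 : probOf p Y v.2 ≠ 0 := mt (probOf_eq_zero_of_comp (X := fun ω => (X ω, Y ω)) Prod.snd) h
    rw [Real.log_mul h1 h2]
    ring

theorem mutualInfo_eq_zero_iff [Fintype α] [Fintype β] (p : PMF Ω) (X : Ω → α) (Y : Ω → β) :
    mutualInfo p X Y = 0 ↔
      ∀ a b, probOf p (fun ω => (X ω, Y ω)) (a, b) = probOf p X a * probOf p Y b := by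
  rw [mutualInfo_eq_sum]
  constructor
  · intro h a b
    rw [div_eq_zero_iff, or_iff_left log_two_pos'.ne', neg_eq_zero] at h
    refine eq_of_gibbs_equality (P := probOf p fun ω => (X ω, Y ω))
      (q := fun v => probOf p X v.1 * probOf p Y v.2) (probOf_nonneg _ _)
      (fun v => mul_nonneg (probOf_nonneg _ _ _) (probOf_nonneg _ _ _)) (fun v hv => ?_) ?_ h (a, b)
    · rcases mul_eq_zero.1 hv with h | h
      exacts [probOf_eq_zero_of_comp (X := fun ω => (X ω, Y ω)) Prod.fst h,
        probOf_eq_zero_of_comp (X := fun ω => (X ω, Y ω)) Prod.snd h]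
    · rw [sum_probOf, Fintype.sum_prod_type]
      simp_rw [← Finset.mul_sum, sum_probOf, mul_one, sum_probOf]
      exact le_rfl
  · intro h
    rw [Finset.sum_eq_zero, neg_zero, zero_div]
    rintro ⟨a, b⟩ -
    simp [h a b]

theorem shannonEntropy_le_log_card [Fintype α] [Nonempty α] (p : PMF Ω) (X : Ω → α) :
    shannonEntropy p X ≤ Real.log (Fintype.card α) / Real.log 2 := by
  rw [shannonEntropy_eq_sum]
  refine div_le_div_of_nonneg_right ?_ log_two_pos'.le
  have hc : (Fintype.card α : ℝ) ≠ 0 := by simp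
  have key := gibbs_inequality (P := probOf p X) (q := fun _ => (Fintype.card α : ℝ)⁻¹)
    (probOf_nonneg p X) (fun _ => by positivity) (fun a h => absurd h (inv_ne_zero hc))
    (by rw [sum_probOf]; simp [hc])
  simp_rw [mul_sub, Finset.sum_sub_distrib, ← Finset.sum_mul, sum_probOf, Real.log_inv] at key
  linarith

theorem shannonEntropy_eq_log_card [Fintype α] (p : PMF Ω) (X : Ω → α)
    (h : ∀ a b, probOf p X a = probOf p X b) :
    shannonEntropy p X = Real.log (Fintype.card α) / Real.log 2 := by
  have hs := sum_probOf p X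
  have hP : ∀ a, probOf p X a = (Fintype.card α : ℝ)⁻¹ := fun a => by
    rw [Finset.sum_congr rfl fun b _ => h b a] at hs
    simp only [Finset.sum_const, Finset.card_univ, nsmul_eq_mul] at hs
    exact eq_inv_of_mul_eq_one_right hs
  rw [shannonEntropy_eq_sum]
  rw [Finset.sum_congr rfl fun a _ => congrArg (probOf p X a * Real.log ·) (hP a),
    ← Finset.sum_mul, sum_probOf, one_mul, Real.log_inv, neg_neg]

/-- Strong subadditivity in the case where Z is a function of Y. -/
theorem condEntropy_le_of_factorsThrough [Fintype α] [Fintype β] [Fintype γ] (p : PMF Ω)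
    (X : Ω → α) {Y : Ω → β} {Z : Ω → γ} (h : Function.FactorsThrough Z Y) :
    condEntropy p X Y ≤ condEntropy p X Z := by
  have h1 := shannonEntropy_submodular p X Y Z
  have h2 : shannonEntropy p (fun ω => (X ω, Y ω, Z ω)) = shannonEntropy p fun ω => (X ω, Y ω) :=
    shannonEntropy_congr p fun ω ω' => by
      simp only [Prod.mk.injEq]
      exact ⟨fun h => ⟨h.1, h.2.1⟩, fun e => ⟨e.1, e.2, h e.2⟩⟩
  have h3 : shannonEntropy p (fun ω => (Y ω, Z ω)) = shannonEntropy p Y :=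
    shannonEntropy_congr p fun ω ω' => by
      simp only [Prod.mk.injEq]
      exact ⟨fun h => h.1, fun e => ⟨e, h e⟩⟩
  unfold condEntropy
  linarith

theorem condEntropy_eq_zero_of_factorsThrough [Fintype α] [Fintype β] (p : PMF Ω)
    {X : Ω → α} {Y : Ω → β} (h : Function.FactorsThrough X Y) : condEntropy p X Y = 0 := by
  refine sub_eq_zero.2 (shannonEntropy_congr p fun ω ω' => ?_)
  simp only [Prod.mk.injEq]
  exact ⟨fun h => h.2, fun e => ⟨h e, e⟩⟩

theorem condEntropy_le_shannonEntropy [Fintype α] [Fintype β] (p : PMF Ω)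
    (X : Ω → α) (Y : Ω → β) : condEntropy p X Y ≤ shannonEntropy p X := by
  have h := condEntropy_le_of_factorsThrough p X (Y := Y) (Z := fun _ => ()) fun _ _ _ => rfl
  refine h.trans (le_of_eq ?_)
  have h1 : shannonEntropy p (fun _ : Ω => ()) = 0 := by
    rw [shannonEntropy_eq_log_card p _ fun _ _ => rfl]; simp
  unfold condEntropy
  rw [h1, sub_zero]
  exact shannonEntropy_congr p fun ω ω' => by simp

/-- Conditional subadditivity. -/
theorem condEntropy_pi_le {n : ℕ} [Fintype α] [Fintype β] (p : PMF Ω)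
    (X : Fin n → Ω → α) (Y : Ω → β) :
    condEntropy p (fun ω i => X i ω) Y ≤ ∑ i, condEntropy p (X i) Y := by
  induction n with
  | zero =>
    rw [condEntropy_eq_zero_of_factorsThrough p fun _ _ _ => Subsingleton.elim _ _]
    simp
  | succ n ih =>
    rw [Fin.sum_univ_succ]
    have h1 := ih fun i => X i.succ
    have h2 := shannonEntropy_submodular p (X 0) (fun ω (i : Fin n) => X i.succ ω) Y
    have h3 : shannonEntropy p (fun ω => (X 0 ω, (fun i : Fin n => X i.succ ω), Y ω)) =
        shannonEntropy p (fun ω => ((fun i => X i ω), Y ω)) :=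
      shannonEntropy_congr p fun ω ω' => by
        simp only [Prod.mk.injEq, funext_iff, Fin.forall_fin_succ, and_assoc]
    unfold condEntropy at *
    linarith

/-! ### Independent pairs -/

theorem indepPair_apply (p : PMF α) (q : PMF β) (a : α) (b : β) :
    indepPair p q (a, b) = p a * q b := by
  classical
  unfold indepPair
  rw [PMF.bind_apply, tsum_eq_single a]
  · rw [PMF.map_apply, tsum_eq_single b]
    · simp
    · intro b' hb'
      simp [Ne.symm hb']
  · intro a' ha'
    simp [PMF.map_apply, Ne.symm ha']

theorem indepPair_map (p : PMF α) (q : PMF β) (f : α → γ) (g : β → δ) :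
    (indepPair p q).map (fun x => (f x.1, g x.2)) = indepPair (p.map f) (q.map g) := by
  unfold indepPair
  rw [PMF.map_bind, PMF.bind_map]
  congr 1
  funext a
  simp only [PMF.map_comp, Function.comp_def]

theorem indepPair_map_fst (p : PMF α) (q : PMF β) : (indepPair p q).map Prod.fst = p := by
  unfold indepPair
  rw [PMF.map_bind]
  simp only [PMF.map_comp, Function.comp_def]
  exact (congrArg p.bind (funext fun a => PMF.map_const q a)).trans (PMF.bind_pure p)

theorem indepPair_map_snd (p : PMF α) (q : PMF β) : (indepPair p q).map Prod.snd = q := by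
  unfold indepPair
  rw [PMF.map_bind]
  simp only [PMF.map_comp, Function.comp_def]
  rw [show (q.map fun x => x) = q from PMF.map_id q, PMF.bind_const]

theorem probOf_indepPair (p : PMF α) (q : PMF β) (f : α → γ) (g : β → δ) (c : γ) (d : δ) :
    probOf (indepPair p q) (fun x => (f x.1, g x.2)) (c, d) = probOf p f c * probOf q g d := by
  unfold probOf
  rw [indepPair_map, indepPair_apply, ENNReal.toReal_mul]

theorem probOf_indepPair_fst (p : PMF α) (q : PMF β) (f : α → γ) (c : γ) :
    probOf (indepPair p q) (fun x => f x.1) c = probOf p f c := by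
  unfold probOf
  rw [show (fun x : α × β => f x.1) = f ∘ Prod.fst from rfl, ← PMF.map_comp, indepPair_map_fst]

theorem probOf_indepPair_snd (p : PMF α) (q : PMF β) (g : β → δ) (d : δ) :
    probOf (indepPair p q) (fun x => g x.2) d = probOf q g d := by
  unfold probOf
  rw [show (fun x : α × β => g x.2) = g ∘ Prod.snd from rfl, ← PMF.map_comp, indepPair_map_snd]

theorem shannonEntropy_indepPair [Fintype γ] [Fintype δ] (p : PMF α) (q : PMF β) (f : α → γ)
    (g : β → δ) :
    shannonEntropy (indepPair p q) (fun x => (f x.1, g x.2)) =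
      shannonEntropy (indepPair p q) (fun x => f x.1) +
      shannonEntropy (indepPair p q) (fun x => g x.2) := by
  have h := (mutualInfo_eq_zero_iff (indepPair p q) (fun x => f x.1) (fun x => g x.2)).2
    fun a b => by rw [probOf_indepPair, probOf_indepPair_fst, probOf_indepPair_snd]
  unfold mutualInfo at h
  linarith

/-- The joint law of a parameter and a random variable whose law is selected by the parameter. -/
theorem probOf_indepPair_param [Fintype γ] (p : PMF α) (q : PMF β) (Y : α → β → γ) (a : α)
    (c : γ) : probOf (indepPair p q) (fun x => (x.1, Y x.1 x.2)) (a, c) =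
      (p a).toReal * probOf q (Y a) c := by
  classical
  have h : (indepPair p q).map (fun x => (x.1, Y x.1 x.2)) =
      p.bind fun a => (q.map (Y a)).map fun c => (a, c) := by
    unfold indepPair
    rw [PMF.map_bind]
    simp only [PMF.map_comp, Function.comp_def]
  unfold probOf
  rw [h, PMF.bind_apply, tsum_eq_single a, ENNReal.toReal_mul]
  · rw [PMF.map_apply (fun c => (a, c)), tsum_eq_single c]
    · simp
    · intro c' hc'
      simp [Ne.symm hc']
  · intro a' ha'
    rw [PMF.map_apply (fun c => (a', c))]
    simp [Ne.symm ha']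

/-- Reduces privacy, for every prior at once, to the law of a database's view being the same for all
demands. -/
theorem mutualInfo_param_eq_zero [Fintype α] [Fintype γ] (p : PMF α) (q : PMF β)
    (Y : α → β → γ) (h : ∀ a a', q.map (Y a) = q.map (Y a')) :
    mutualInfo (indepPair p q) (fun x => x.1) (fun x => Y x.1 x.2) = 0 := by
  rw [mutualInfo_eq_zero_iff]
  intro a c
  have hp : ∑ a, (p a).toReal = 1 := by
    have := sum_probOf p id
    unfold probOf at this
    rwa [PMF.map_id] at this
  rw [probOf_indepPair_param, ← sum_probOf_fst (indepPair p q) (fun x => x.1) (fun x => Y x.1 x.2)]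
  rw [Finset.sum_congr rfl fun a' _ => probOf_indepPair_param p q Y a' c]
  have h' : ∀ a', probOf q (Y a') c = probOf q (Y a) c := fun a' => by
    unfold probOf; rw [h a' a]
  rw [Finset.sum_congr rfl fun a' _ => congrArg ((p a').toReal * ·) (h' a'), ← Finset.sum_mul, hp,
    one_mul]
  rw [probOf_indepPair_fst p q (fun x => x)]
  unfold probOf
  rw [show (p.map fun x => x) = p from PMF.map_id p]

/-- Independence gives p(a) P(Y_a = c) = p(a) P(Y = c); full support of the prior allows cancelling
p(a). -/
theorem map_eq_of_mutualInfo_param_eq_zero [Fintype α] [Fintype γ] (p : PMF α) (q : PMF β)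
    (Y : α → β → γ) (hp : ∀ a, p a ≠ 0)
    (h : mutualInfo (indepPair p q) (fun x => x.1) (fun x => Y x.1 x.2) = 0) (a a' : α) :
    q.map (Y a) = q.map (Y a') := by
  rw [mutualInfo_eq_zero_iff] at h
  ext c
  have key : ∀ a, probOf q (Y a) c = probOf (indepPair p q) (fun x => Y x.1 x.2) c := fun a => by
    have h1 := h a c
    rw [probOf_indepPair_param, probOf_indepPair_fst p q (fun x => x)] at h1
    unfold probOf at h1 ⊢
    rw [show (p.map fun x => x) = p from PMF.map_id p] at h1
    exact mul_left_cancel₀ (ENNReal.toReal_ne_zero.2 ⟨hp a, PMF.apply_ne_top p a⟩) h1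
  have := (key a).trans (key a').symm
  unfold probOf at this
  exact (ENNReal.toReal_eq_toReal_iff' (PMF.apply_ne_top _ _) (PMF.apply_ne_top _ _)).1 this

theorem shannonEntropy_congr_law [Fintype α] [Fintype β] (p : PMF Ω) {X Y : Ω → α}
    (h : p.map X = p.map Y) (f : α → β) :
    shannonEntropy p (fun ω => f (X ω)) = shannonEntropy p (fun ω => f (Y ω)) := by
  have : p.map (fun ω => f (X ω)) = p.map (fun ω => f (Y ω)) := by
    rw [show (fun ω => f (X ω)) = f ∘ X from rfl, show (fun ω => f (Y ω)) = f ∘ Y from rfl,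
      ← PMF.map_comp, ← PMF.map_comp, h]
  unfold shannonEntropy
  rw [this]

end Entropy

/-! ### The converse bound -/

namespace MuPIRScheme

variable {K Ku N : ℕ} (S : MuPIRScheme K Ku N)

theorem shannonEntropy_library_seed {α β : Type*} [Fintype α] [Fintype β]
    (f : Library K S.L → α) (g : S.Seed → β) :
    shannonEntropy S.law (fun ω => (f ω.1, g ω.2)) =
      shannonEntropy S.law (fun ω => f ω.1) + shannonEntropy S.law (fun ω => g ω.2) :=
  shannonEntropy_indepPair _ _ f g

theorem shannonEntropy_library_equiv {α : Type*} [Fintype α] (e : Library K S.L ≃ α) :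
    shannonEntropy S.law (fun ω => e ω.1) = K * S.L := by
  rw [shannonEntropy_eq_log_card]
  · rw [← Fintype.card_congr e]
    simp only [Fintype.card_pi, Fintype.card_bool, Finset.prod_const, Finset.card_univ,
      Fintype.card_fin, Nat.cast_pow, Nat.cast_ofNat, Real.log_pow]
    field_simp
  · intro a b
    have h : ∀ c, probOf S.law (fun ω => e ω.1) c =
        ((Fintype.card (Library K S.L) : ENNReal)⁻¹).toReal := fun c => by
      unfold law
      rw [probOf_indepPair_fst]
      unfold probOf
      rw [PMF.map_apply, tsum_eq_single (e.symm c)]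
      · simp
      · intro w hw
        rw [if_neg]
        rintro rfl
        simp at hw
    rw [h, h]

theorem shannonEntropy_cache_le (u : Fin Ku) :
    shannonEntropy S.law (S.Z u) ≤ S.cacheBits u := by
  refine (shannonEntropy_le_log_card _ _).trans (le_of_eq ?_)
  have := log_two_pos'.ne'
  simp only [Fintype.card_pi, Fintype.card_bool, Finset.prod_const, Finset.card_univ,
    Fintype.card_fin, Nat.cast_pow, Nat.cast_ofNat, Real.log_pow]
  field_simp

/-- What database `n` sees has the same law for all demand vectors. -/
theorem Private.map_eq {S : MuPIRScheme K Ku N} (h : S.Private) [Nonempty (Demand K Ku)]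
    (n : Fin N) (θ θ' : Demand K Ku) :
    S.law.map (fun ω => (S.Q θ n ω, S.A θ n ω, ω.1, fun u => S.Z u ω)) =
      S.law.map (fun ω => (S.Q θ' n ω, S.A θ' n ω, ω.1, fun u => S.Z u ω)) :=
  map_eq_of_mutualInfo_param_eq_zero (PMF.uniformOfFintype (Demand K Ku)) S.law
    (fun θ ω => (S.Q θ n ω, S.A θ n ω, ω.1, fun u => S.Z u ω)) (fun a => by simp)
    (h _ n) θ θ'

/-- Given the query to a database, its answer does not depend on the other queries. -/
theorem condEntropy_answer_query_le {α : Type*} [Fintype α] (θ : Demand K Ku) (n : Fin N)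
    (f : Library K S.L → α) :
    condEntropy S.law (S.A θ n) (fun ω => (S.Q θ n ω, f ω.1)) ≤
      condEntropy S.law (S.A θ n) (fun ω => ((fun n => S.Q θ n ω), f ω.1)) := by
  have h1 := S.shannonEntropy_library_seed f (fun r => S.query θ r n)
  have h2 := S.shannonEntropy_library_seed f (S.query θ)
  have h3 := S.shannonEntropy_library_seed id (fun r => S.query θ r n)
  have h4 := S.shannonEntropy_library_seed id (S.query θ)
  -- The Markov chain (all queries) – Q_n – (W, A_n): as A_n is a function of Q_n and W, the
  -- entropies containing W collapse to those of the library and the queries, which split by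
  -- independence.
  have h5 := shannonEntropy_submodular S.law (fun ω => S.query θ ω.2) (fun ω => ω.1)
    (fun ω => (S.A θ n ω, S.query θ ω.2 n, f ω.1))
  have e1 : shannonEntropy S.law (fun ω => (S.query θ ω.2, ω.1, S.A θ n ω, S.query θ ω.2 n, f ω.1))
      = shannonEntropy S.law (fun ω => (id ω.1, S.query θ ω.2)) :=
    shannonEntropy_congr _ fun ω ω' => by
      simp only [Prod.mk.injEq, A, Q, id]
      constructor
      · exact fun h => ⟨h.2.1, h.1⟩
      · rintro ⟨h1, h2⟩
        simp [h1, h2]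
  have e2 : shannonEntropy S.law (fun ω => (ω.1, S.A θ n ω, S.query θ ω.2 n, f ω.1))
      = shannonEntropy S.law (fun ω => (id ω.1, S.query θ ω.2 n)) :=
    shannonEntropy_congr _ fun ω ω' => by
      simp only [Prod.mk.injEq, A, Q, id]
      constructor
      · exact fun h => ⟨h.1, h.2.2.1⟩
      · rintro ⟨h1, h2⟩
        simp [h1, h2]
  have e3 : shannonEntropy S.law (fun ω => (S.query θ ω.2, S.A θ n ω, S.query θ ω.2 n, f ω.1))
      = shannonEntropy S.law (fun ω => (S.A θ n ω, (fun n => S.Q θ n ω), f ω.1)) :=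
    shannonEntropy_congr _ fun ω ω' => by
      simp only [Prod.mk.injEq]
      constructor
      · exact fun h => ⟨h.2.1, h.1, h.2.2.2⟩
      · rintro ⟨h1, h2, h3⟩
        exact ⟨h2, h1, congrFun h2 n, h3⟩
  have e4 : shannonEntropy S.law (fun ω => ((fun n => S.Q θ n ω), f ω.1)) =
      shannonEntropy S.law (fun ω => (f ω.1, S.query θ ω.2)) :=
    shannonEntropy_congr _ fun ω ω' => by
      simp only [Prod.mk.injEq]
      exact and_comm
  have e5 : shannonEntropy S.law (fun ω => (S.Q θ n ω, f ω.1)) =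
      shannonEntropy S.law (fun ω => (f ω.1, S.query θ ω.2 n)) :=
    shannonEntropy_congr _ fun ω ω' => by
      simp only [Prod.mk.injEq]
      exact and_comm
  have e6 : shannonEntropy S.law (fun ω => (S.A θ n ω, S.Q θ n ω, f ω.1)) =
      shannonEntropy S.law (fun ω => (S.A θ n ω, S.query θ ω.2 n, f ω.1)) := rfl
  unfold condEntropy
  linarith

theorem condEntropy_query_pair {α β : Type*} [Fintype α] [Fintype β]
    (θ : Demand K Ku) (f : Library K S.L → α) (g : Library K S.L → β) :
    condEntropy S.law (fun ω => f ω.1) (fun ω => ((fun n => S.Q θ n ω), g ω.1)) =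
      condEntropy S.law (fun ω => f ω.1) (fun ω => g ω.1) := by
  have h1 := S.shannonEntropy_library_seed (fun w => (f w, g w)) (S.query θ)
  have h2 := S.shannonEntropy_library_seed g (S.query θ)
  have e1 : shannonEntropy S.law (fun ω => (f ω.1, (fun n => S.Q θ n ω), g ω.1)) =
      shannonEntropy S.law (fun ω => ((f ω.1, g ω.1), S.query θ ω.2)) :=
    shannonEntropy_congr _ fun ω ω' => by
      simp only [Prod.mk.injEq, and_assoc]
      exact and_congr_right fun _ => and_comm
  have e2 : shannonEntropy S.law (fun ω => ((fun n => S.Q θ n ω), g ω.1)) =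
      shannonEntropy S.law (fun ω => (g ω.1, S.query θ ω.2)) :=
    shannonEntropy_congr _ fun ω ω' => by
      simp only [Prod.mk.injEq]
      exact and_comm
  unfold condEntropy
  linarith

/-- The answers determine the demanded message, given the queries and the cache, hence have at
least its conditional entropy given side information on the library. -/
theorem Decodable.condEntropy_message_le {S : MuPIRScheme K Ku N} (h : S.Decodable)
    {α : Type*} [Fintype α] (θ : Demand K Ku) (u : Fin Ku) (g : Library K S.L → α)
    (hg : Function.FactorsThrough (S.cache u) g) :
    condEntropy S.law (fun ω => ω.1 (θ u)) (fun ω => g ω.1) +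
      condEntropy S.law (fun ω n => S.A θ n ω)
        (fun ω => ((fun n => S.Q θ n ω), g ω.1, ω.1 (θ u))) ≤
      condEntropy S.law (fun ω n => S.A θ n ω) (fun ω => ((fun n => S.Q θ n ω), g ω.1)) := by
  rw [← S.condEntropy_query_pair θ (fun w => w (θ u)) g]
  have h1 := condEntropy_le_of_factorsThrough S.law (fun ω => ω.1 (θ u))
    (Y := fun ω => ((fun n => S.A θ n ω), (fun n => S.Q θ n ω), g ω.1))
    (Z := fun ω => ((fun n => S.Q θ n ω), (fun n => S.A θ n ω), S.Z u ω)) (fun ω ω' e => by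
      simp only [Prod.mk.injEq] at e ⊢
      exact ⟨e.2.1, e.1, hg e.2.2⟩)
  rw [h θ u] at h1
  have e1 : shannonEntropy S.law (fun ω => (ω.1 (θ u), (fun n => S.A θ n ω),
      (fun n => S.Q θ n ω), g ω.1)) = shannonEntropy S.law (fun ω => ((fun n => S.A θ n ω),
      (fun n => S.Q θ n ω), g ω.1, ω.1 (θ u))) :=
    shannonEntropy_congr _ fun ω ω' => by
      simp only [Prod.mk.injEq]
      tauto
  have e2 : shannonEntropy S.law (fun ω => (ω.1 (θ u), (fun n => S.Q θ n ω), g ω.1)) =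
      shannonEntropy S.law (fun ω => ((fun n => S.Q θ n ω), g ω.1, ω.1 (θ u))) :=
    shannonEntropy_congr _ fun ω ω' => by
      simp only [Prod.mk.injEq]
      tauto
  unfold condEntropy at *
  linarith

theorem condEntropy_answer_le_sum {α : Type*} [Fintype α] (θ : Demand K Ku)
    (Y : S.Sample → α) :
    condEntropy S.law (fun ω n => S.A θ n ω) Y ≤ ∑ n, shannonEntropy S.law (S.A θ n) :=
  (condEntropy_pi_le S.law (S.A θ) Y).trans
    (Finset.sum_le_sum fun _ _ => condEntropy_le_shannonEntropy _ _ _)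

/-- The interference in the answers to `θ` costs at least a fraction `1 / N` of the uncertainty on
a message which is demanded under `θ'`. -/
theorem converse_step {S : MuPIRScheme K Ku N} (hd : S.Decodable) (hp : S.Private)
    (u : Fin Ku) (θ θ' : Demand K Ku) :
    N * condEntropy S.law (fun ω => ω.1 (θ u)) (S.Z u) +
      condEntropy S.law (fun ω => ω.1 (θ' u)) (fun ω => (S.Z u ω, ω.1 (θ u))) ≤
      N * ∑ n, shannonEntropy S.law (S.A θ n) := by
  have : Nonempty (Demand K Ku) := ⟨θ⟩
  have h1 := hd.condEntropy_message_le θ u (S.cache u) fun _ _ e => e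
  -- The message W_θ is granted as extra side information when decoding under θ'.
  have h2 := hd.condEntropy_message_le θ' u (fun w => (S.cache u w, w (θ u)))
    fun _ _ e => congrArg Prod.fst e
  have h3 : ∀ n, condEntropy S.law (S.A θ' n)
      (fun ω => ((fun n => S.Q θ' n ω), S.Z u ω, ω.1 (θ u))) ≤
      ∑ n, shannonEntropy S.law (S.A θ n) -
        condEntropy S.law (fun ω => ω.1 (θ u)) (S.Z u) := fun n => by
    have a1 := condEntropy_le_of_factorsThrough S.law (S.A θ' n)
      (Y := fun ω => ((fun n => S.Q θ' n ω), S.Z u ω, ω.1 (θ u)))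
      (Z := fun ω => (S.Q θ' n ω, S.Z u ω, ω.1 (θ u))) (fun ω ω' e => by
        simp only [Prod.mk.injEq] at e ⊢
        exact ⟨congrFun e.1 n, e.2⟩)
    -- Privacy is used here, for database n alone.
    have a2 : condEntropy S.law (S.A θ' n) (fun ω => (S.Q θ' n ω, S.Z u ω, ω.1 (θ u))) =
        condEntropy S.law (S.A θ n) (fun ω => (S.Q θ n ω, S.Z u ω, ω.1 (θ u))) := by
      have hl := hp.map_eq n θ' θ
      have b1 := shannonEntropy_congr_law S.law hl
        fun x => (x.2.1, x.1, x.2.2.2 u, x.2.2.1 (θ u))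
      have b2 := shannonEntropy_congr_law S.law hl fun x => (x.1, x.2.2.2 u, x.2.2.1 (θ u))
      dsimp only at b1 b2
      unfold condEntropy
      rw [b1, b2]
    have a3 := S.condEntropy_answer_query_le θ n fun w => (S.cache u w, w (θ u))
    have a4 : condEntropy S.law (S.A θ n)
        (fun ω => ((fun n => S.Q θ n ω), S.Z u ω, ω.1 (θ u))) ≤
        condEntropy S.law (fun ω n => S.A θ n ω)
        (fun ω => ((fun n => S.Q θ n ω), S.Z u ω, ω.1 (θ u))) :=
      sub_le_sub_right (shannonEntropy_le_of_factorsThrough _ fun ω ω' e => by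
        simp only [Prod.mk.injEq] at e ⊢
        exact ⟨congrFun e.1 n, e.2⟩) _
    have a5 := S.condEntropy_answer_le_sum θ fun ω => ((fun n => S.Q θ n ω), S.cache u ω.1)
    exact (a1.trans_eq a2).trans ((a3.trans a4).trans (le_sub_iff_add_le'.2 (h1.trans a5)))
  have h4 := condEntropy_pi_le S.law (S.A θ')
    (fun ω => ((fun n => S.Q θ' n ω), S.Z u ω, ω.1 (θ u)))
  have h5 := Finset.sum_le_sum fun n (_ : n ∈ Finset.univ) => h3 n
  simp only [Finset.sum_const, Finset.card_univ, Fintype.card_fin, nsmul_eq_mul] at h5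
  have h6 : 0 ≤ condEntropy S.law (fun ω n => S.A θ' n ω)
      (fun ω => ((fun n => S.Q θ' n ω), (S.cache u ω.1, ω.1 (θ u)), ω.1 (θ' u))) :=
    sub_nonneg.2 (shannonEntropy_le_of_factorsThrough _ fun _ _ e => congrArg Prod.snd e)
  have h7 : condEntropy S.law (fun ω => ω.1 (θ' u)) (fun ω => (S.Z u ω, ω.1 (θ u))) ≤
      N * (∑ n, shannonEntropy S.law (S.A θ n) -
        condEntropy S.law (fun ω => ω.1 (θ u)) (S.Z u)) :=
    (le_add_of_nonneg_right h6).trans (h2.trans (h4.trans h5))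
  linarith

end MuPIRScheme

/-- Symmetrizes `converse_step` over the two constant demand vectors, so that only H(W_0, Z) +
H(W_1, Z) enters, which submodularity bounds below. -/
theorem Achievable.le_load {Ku N : ℕ} (hKu : 0 < Ku) (hN : 0 < N) {M R : ℝ}
    (h : Achievable 2 Ku N M R) : (1 - M / 2) * (1 + 1 / (N : ℝ)) ≤ R := by
  obtain ⟨S, hd, hp, hM, hR⟩ := h
  set u : Fin Ku := ⟨0, hKu⟩
  have hL : (0 : ℝ) < S.L := by exact_mod_cast S.L_pos
  have hN0 : (1 : ℝ) ≤ N := by exact_mod_cast hN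
  have hload : ∀ θ, ∑ n, shannonEntropy S.law (S.A θ n) = R * S.L := fun θ => by
    rw [← hR θ, MuPIRScheme.load]
    field_simp
  have h0 := MuPIRScheme.converse_step hd hp u (fun _ => 0) (fun _ => 1)
  have h1 := MuPIRScheme.converse_step hd hp u (fun _ => 1) (fun _ => 0)
  rw [hload] at h0 h1
  have hW := S.shannonEntropy_library_equiv (Equiv.refl _)
  have hZ := (S.shannonEntropy_cache_le u).trans (hM u)
  have e : ∀ i j : Fin 2, i ≠ j → shannonEntropy S.law (fun ω => (ω.1 i, S.Z u ω, ω.1 j)) =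
      2 * S.L := fun i j hij => by
    rw [Nat.cast_ofNat] at hW
    rw [← hW]
    refine shannonEntropy_congr _ fun ω ω' => ?_
    simp only [Prod.mk.injEq, Equiv.refl_apply]
    constructor
    · rintro ⟨hi, -, hj⟩
      funext k
      have : k = i ∨ k = j := by omega
      rcases this with rfl | rfl <;> assumption
    · intro h
      exact ⟨by rw [h], by unfold MuPIRScheme.Z; rw [h], by rw [h]⟩
  have e0 := e 1 0 (by decide)
  have e1 := e 0 1 (by decide)
  have sw : ∀ i : Fin 2, shannonEntropy S.law (fun ω => (S.Z u ω, ω.1 i)) =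
      shannonEntropy S.law (fun ω => (ω.1 i, S.Z u ω)) := fun i =>
    shannonEntropy_congr _ fun ω ω' => by
      simp only [Prod.mk.injEq]
      exact and_comm
  have hsub := shannonEntropy_submodular S.law (fun ω => ω.1 0) (fun ω => ω.1 1) (S.Z u)
  have e2 : shannonEntropy S.law (fun ω => (ω.1 0, ω.1 1, S.Z u ω)) = 2 * S.L := by
    rw [← e1]
    exact shannonEntropy_congr _ fun ω ω' => by
      simp only [Prod.mk.injEq]
      tauto
  unfold condEntropy at h0 h1
  rw [sw, e0] at h0
  rw [sw, e1] at h1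
  rw [e2] at hsub
  have hmul : (1 - M / 2) * (1 + 1 / (N : ℝ)) = (2 - M) * (N + 1) / (2 * N) := by
    field_simp
  rw [hmul, div_le_iff₀ (by positivity)]
  set a := shannonEntropy S.law (fun ω => (ω.1 0, S.Z u ω))
  set b := shannonEntropy S.law (fun ω => (ω.1 1, S.Z u ω))
  set z := shannonEntropy S.law (S.Z u)
  -- The sum of `h0` and `h1` contains (N - 1)(a + b), hence the multiplier N - 1 ≥ 0 on the
  -- submodularity bound.
  have k : ((2 - M) * (N + 1)) * S.L ≤ (R * (2 * N)) * S.L := by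
    nlinarith [mul_nonneg (sub_nonneg.2 hN0) (sub_nonneg.2 hsub)]
  exact le_of_mul_le_mul_right k hL

/-! ### The scheme -/

namespace MuPIRScheme

section Uniform

theorem uniformOfFintype_map_equiv {α β : Type*} [Fintype α] [Nonempty α] [Fintype β] [Nonempty β]
    (e : α ≃ β) : (PMF.uniformOfFintype α).map e = PMF.uniformOfFintype β := by
  classical
  ext b
  rw [PMF.map_apply, tsum_eq_single (e.symm b)]
  · simp [Fintype.card_congr e]
  · intro a ha
    rw [if_neg]
    rintro rfl
    simp at ha

/-- A random variable that can be shifted arbitrarily by permutations of the library is uniform. -/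
theorem shannonEntropy_of_shift {K Ku N : ℕ} (S : MuPIRScheme K Ku N) {G : Type*} [AddGroup G]
    [Fintype G] (X : S.Sample → G)
    (h : ∀ c, ∃ e : Library K S.L ≃ Library K S.L, ∀ w r, X (e w, r) = X (w, r) + c) :
    shannonEntropy S.law X = Real.log (Fintype.card G) / Real.log 2 := by
  refine shannonEntropy_eq_log_card _ _ fun a b => ?_
  -- The shift that carries the value b to a.
  obtain ⟨e, he⟩ := h (-b + a)
  have hlaw : S.law.map (fun x => (e x.1, x.2)) = S.law := by
    have := indepPair_map (PMF.uniformOfFintype (Library K S.L)) S.seedLaw e id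
    rw [uniformOfFintype_map_equiv, PMF.map_id] at this
    exact this
  have hX : S.law.map X = (S.law.map X).map (Equiv.addRight (-b + a)) := by
    rw [PMF.map_comp]
    conv_lhs => rw [← hlaw, PMF.map_comp]
    congr 1
    funext x
    exact he x.1 x.2
  unfold probOf
  conv_lhs => rw [hX]
  classical
  rw [PMF.map_apply, tsum_eq_single b]
  · simp
  · intro c hc
    rw [if_neg]
    intro hac
    apply hc
    simp only [Equiv.coe_addRight] at hac
    have := add_right_cancel (hac.symm.trans (add_neg_cancel_left b a).symm)
    exact this

end Uniform

/-- Positions of a message: `m` blocks, each consisting of `d` bits for each user (missing from the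
cache of this user only) and of one bit which is not cached, and `s` bits cached by all users. -/
abbrev Position (Ku d m s : ℕ) : Type := (Fin m × Option (Fin Ku × Fin d)) ⊕ Fin s

/-- Positions of a message cached by user `u`. -/
abbrev CachedPosition (Ku d m s : ℕ) (u : Fin Ku) : Type :=
  (Fin m × {k : Fin Ku // k ≠ u} × Fin d) ⊕ Fin s

variable {Ku d m s : ℕ}

/-- The position in the message. -/
def CachedPosition.toPosition {u : Fin Ku} : CachedPosition Ku d m s u → Position Ku d m s
  | .inl (l, k, j) => .inl (l, some (k.1, j))
  | .inr x => .inr x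

/-- A library of two messages, indexed by the positions above. -/
abbrev PositionLibrary (Ku d m s : ℕ) : Type := Fin 2 → Position Ku d m s → Bool

/-- Coefficients of the linear combinations which are asked for. -/
abbrev CoeffQuery (Ku d : ℕ) : Type := Fin Ku → Fin 2 → Fin d → Bool

/-- The bit of message `i` asked for in block `l` by the query `q`. -/
def combine (q : CoeffQuery Ku d) (V : PositionLibrary Ku d m s) (i : Fin 2) (l : Fin m) : Bool :=
  V i (.inl (l, none)) + ∑ k, ∑ j, q k i j * V i (.inl (l, some (k, j)))

/-- The query to database `n`. -/
def maskedQuery (θ : Demand 2 Ku) (r : CoeffQuery Ku d) (n : Fin (d + 1)) : CoeffQuery Ku d :=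
  fun k i j => r k i j + if θ k = i ∧ n = j.succ then 1 else 0

/-- Database `0` answers with both combinations, the others with their sum. -/
def combineAnswer (n : Fin (d + 1)) (q : CoeffQuery Ku d) (V : PositionLibrary Ku d m s) :
    Fin m → Bool × Bool :=
  fun l => if n = 0 then (combine q V 0 l, combine q V 1 l)
    else (combine q V 0 l + combine q V 1 l, 0)

/-! ### Decoding from the masked combinations -/

theorem maskedQuery_zero (θ : Demand 2 Ku) (r : CoeffQuery Ku d) : maskedQuery θ r 0 = r := by
  funext k i j
  simp [maskedQuery, (Fin.succ_ne_zero j).symm]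

/-- The random part cancels against the sum of the two answers of database 0; what remains is the
multicast sum, in which user u has cached every term but its own. -/
theorem combine_maskedQuery_succ (θ : Demand 2 Ku) (r : CoeffQuery Ku d)
    (V : PositionLibrary Ku d m s) (l : Fin m) (j : Fin d) :
    combine (maskedQuery θ r j.succ) V 0 l + combine (maskedQuery θ r j.succ) V 1 l =
      combine r V 0 l + combine r V 1 l + ∑ k, V (θ k) (.inl (l, some (k, j))) := by
  have h : ∀ i, combine (maskedQuery θ r j.succ) V i l = combine r V i l +
      ∑ k, if θ k = i then V i (.inl (l, some (k, j))) else 0 := fun i => by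
    simp only [combine, maskedQuery, add_mul, Finset.sum_add_distrib, ite_mul, one_mul, zero_mul,
      Fin.succ_inj, ite_and, add_assoc]
    congr 2
    refine Finset.sum_congr rfl fun k _ => ?_
    split_ifs <;> simp
  rw [h 0, h 1, add_add_add_comm, ← Finset.sum_add_distrib]
  congr 1
  refine Finset.sum_congr rfl fun k _ => ?_
  have : θ k = 0 ∨ θ k = 1 := by omega
  rcases this with h | h <;> simp [h]

/-- User u isolates its own d bits in each block from the multicast sums. All cached-by-some bits of
its message are then known, and the answer of database 0 reveals the remaining one. -/
theorem eq_of_combineAnswer_eq (θ : Demand 2 Ku) (r : CoeffQuery Ku d) (u : Fin Ku)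
    (V V' : PositionLibrary Ku d m s)
    (hA : ∀ n, combineAnswer n (maskedQuery θ r n) V = combineAnswer n (maskedQuery θ r n) V')
    (hZ : ∀ i (x : CachedPosition Ku d m s u), V i x.toPosition = V' i x.toPosition) :
    V (θ u) = V' (θ u) := by
  have hc : ∀ i l (k : Fin Ku) j, k ≠ u →
      V i (.inl (l, some (k, j))) = V' i (.inl (l, some (k, j))) :=
    fun i l k j hk => hZ i (.inl (l, ⟨k, hk⟩, j))
  have h0 : ∀ i l, combine r V i l = combine r V' i l := fun i l => by
    have h := congrFun (hA 0) l
    simp only [combineAnswer, maskedQuery_zero, if_true, Prod.mk.injEq] at h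
    have : i = 0 ∨ i = 1 := by omega
    rcases this with rfl | rfl
    exacts [h.1, h.2]
  have hu : ∀ l j, V (θ u) (.inl (l, some (u, j))) = V' (θ u) (.inl (l, some (u, j))) :=
    fun l j => by
      have h := congrFun (hA j.succ) l
      simp only [combineAnswer, if_neg (Fin.succ_ne_zero j), Prod.mk.injEq, and_true] at h
      rw [combine_maskedQuery_succ, combine_maskedQuery_succ, h0, h0] at h
      have h' := add_left_cancel h
      rw [← Finset.add_sum_erase _ _ (Finset.mem_univ u),
        ← Finset.add_sum_erase _ _ (Finset.mem_univ u),
        Finset.sum_congr rfl fun k hk => hc (θ k) l k j (Finset.ne_of_mem_erase hk)] at h'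
      exact add_right_cancel h'
  have hs : ∀ l k j, V (θ u) (.inl (l, some (k, j))) = V' (θ u) (.inl (l, some (k, j))) :=
    fun l k j => by
      rcases eq_or_ne k u with rfl | hk
      exacts [hu l j, hc _ l k j hk]
  funext x
  rcases x with ⟨l, _ | ⟨k, j⟩⟩ | x
  · have h := h0 (θ u) l
    simp only [combine, hs] at h
    exact add_right_cancel h
  · exact hs l k j
  · exact hZ _ (.inr x)

/-- Shift of the bits which are not cached. -/
def shiftEquiv (c : Fin 2 → Fin m → Bool) : PositionLibrary Ku d m s ≃ PositionLibrary Ku d m s :=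
  Equiv.addRight fun i x => match x with
    | .inl (l, none) => c i l
    | _ => 0

/-- The uncached bit has coefficient 1 whatever the query, so answers can be shifted at will; this
makes them uniform even for the zero query. -/
theorem combine_shiftEquiv (c : Fin 2 → Fin m → Bool) (q : CoeffQuery Ku d)
    (V : PositionLibrary Ku d m s) (i : Fin 2) (l : Fin m) :
    combine q (shiftEquiv c V) i l = combine q V i l + c i l := by
  simp only [combine, shiftEquiv, Equiv.coe_addRight, Pi.add_apply, add_zero]
  exact add_right_comm _ _ _

/-- Positions are numbered by `Fin L`. -/
noncomputable def positionLibraryEquiv (Ku d m s : ℕ) :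
    Library 2 (Fintype.card (Position Ku d m s)) ≃ PositionLibrary Ku d m s :=
  Equiv.arrowCongr (Equiv.refl _)
    (Equiv.arrowCongr (Fintype.equivFin (Position Ku d m s)).symm (Equiv.refl _))

theorem positionLibraryEquiv_apply (W : Library 2 (Fintype.card (Position Ku d m s))) (i : Fin 2)
    (x : Position Ku d m s) :
    positionLibraryEquiv Ku d m s W i x = W i (Fintype.equivFin (Position Ku d m s) x) := rfl

theorem eq_of_positionLibraryEquiv_eq (W W' : Library 2 (Fintype.card (Position Ku d m s)))
    {i : Fin 2} (h : positionLibraryEquiv Ku d m s W i = positionLibraryEquiv Ku d m s W' i) :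
    W i = W' i := by
  funext y
  have := congrFun h ((Fintype.equivFin (Position Ku d m s)).symm y)
  rwa [positionLibraryEquiv_apply, positionLibraryEquiv_apply, Equiv.apply_symm_apply] at this

/-- Shift of the library bits which are not cached. -/
noncomputable def libraryShift (c : Fin 2 → Fin m → Bool) :
    Library 2 (Fintype.card (Position Ku d m s)) ≃ Library 2 (Fintype.card (Position Ku d m s)) :=
  (positionLibraryEquiv Ku d m s).trans
    ((shiftEquiv c).trans (positionLibraryEquiv Ku d m s).symm)

theorem combine_libraryShift (c : Fin 2 → Fin m → Bool) (q : CoeffQuery Ku d)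
    (W : Library 2 (Fintype.card (Position Ku d m s))) (i : Fin 2) (l : Fin m) :
    combine q (positionLibraryEquiv Ku d m s (libraryShift c W)) i l =
      combine q (positionLibraryEquiv Ku d m s W) i l + c i l := by
  rw [libraryShift, Equiv.trans_apply, Equiv.trans_apply, Equiv.apply_symm_apply,
    combine_shiftEquiv]

/-- The scheme for `2` messages, `Ku` users and `d + 1` databases, with `m` coded blocks and `s`
bits of each message cached by all users. -/
noncomputable def blockScheme (Ku d m s : ℕ) (h : 0 < Fintype.card (Position Ku d m s)) :
    MuPIRScheme 2 Ku (d + 1) where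
  L := Fintype.card (Position Ku d m s)
  L_pos := h
  cacheBits u := Fintype.card (Fin 2 × CachedPosition Ku d m s u)
  cache u W x :=
    W ((Fintype.equivFin (Fin 2 × CachedPosition Ku d m s u)).symm x).1
      (Fintype.equivFin (Position Ku d m s)
        ((Fintype.equivFin (Fin 2 × CachedPosition Ku d m s u)).symm x).2.toPosition)
  Seed := CoeffQuery Ku d
  seedLaw := PMF.uniformOfFintype (CoeffQuery Ku d)
  Query := CoeffQuery Ku d
  queryFintype := inferInstance
  Answer := Fin m → Bool × Bool
  answerFintype := inferInstance
  query := maskedQuery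
  answer n q W := combineAnswer n q (positionLibraryEquiv Ku d m s W)

/-! ### Correctness, privacy and load of the block scheme -/

variable (h : 0 < Fintype.card (Position Ku d m s))

theorem blockScheme_isUncoded : (blockScheme Ku d m s h).IsUncoded := fun u =>
  ⟨fun x => (((Fintype.equivFin (Fin 2 × CachedPosition Ku d m s u)).symm x).1,
    Fintype.equivFin (Position Ku d m s)
      ((Fintype.equivFin (Fin 2 × CachedPosition Ku d m s u)).symm x).2.toPosition),
    fun _ _ => rfl⟩

theorem blockScheme_decodable : (blockScheme Ku d m s h).Decodable := fun θ u => by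
  refine condEntropy_eq_zero_of_factorsThrough _ fun ω ω' e => ?_
  obtain ⟨W, r⟩ := ω
  obtain ⟨W', r'⟩ := ω'
  simp only [Prod.mk.injEq] at e
  obtain ⟨hQ, hA, hZ⟩ := e
  -- Database 0 receives the seed unmasked, so equal queries force equal seeds.
  have hr : r = r' := by
    have := congrFun hQ 0
    exact (maskedQuery_zero θ r).symm.trans (this.trans (maskedQuery_zero θ r'))
  subst hr
  have key := eq_of_combineAnswer_eq θ r u (positionLibraryEquiv Ku d m s W)
    (positionLibraryEquiv Ku d m s W') (fun n => congrFun hA n) fun i x => by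
      have := congrFun hZ (Fintype.equivFin (Fin 2 × CachedPosition Ku d m s u) (i, x))
      simp only [Z, blockScheme, Equiv.symm_apply_apply] at this
      exact this
  exact eq_of_positionLibraryEquiv_eq W W' key

/-- For a fixed database the mask is a translation of a uniform seed independent of the library, so
it preserves the joint law. The view is `F ∘ G θ`, where only the measure-preserving `G θ` depends
on the demand. -/
theorem blockScheme_private : (blockScheme Ku d m s h).Private := fun prior n => by
  refine mutualInfo_param_eq_zero prior _ (fun θ ω => ((blockScheme Ku d m s h).Q θ n ω,
    (blockScheme Ku d m s h).A θ n ω, ω.1, fun u => (blockScheme Ku d m s h).Z u ω))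
    fun θ θ' => ?_
  let P : PMF (Library 2 (Fintype.card (Position Ku d m s)) × CoeffQuery Ku d) :=
    (blockScheme Ku d m s h).law
  let G : Demand 2 Ku → Library 2 (Fintype.card (Position Ku d m s)) × CoeffQuery Ku d →
    Library 2 (Fintype.card (Position Ku d m s)) × CoeffQuery Ku d :=
    fun θ ω => (ω.1, maskedQuery θ ω.2 n)
  let F : Library 2 (Fintype.card (Position Ku d m s)) × CoeffQuery Ku d → _ := fun ω =>
    (ω.2, (blockScheme Ku d m s h).answer n ω.2 ω.1, ω.1,
      fun u => (blockScheme Ku d m s h).cache u ω.1)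
  have hlaw : ∀ θ, P.map (G θ) = P := fun θ => by
    have h1 : (PMF.uniformOfFintype (CoeffQuery Ku d)).map (fun r => maskedQuery θ r n) =
        PMF.uniformOfFintype (CoeffQuery Ku d) :=
      uniformOfFintype_map_equiv (Equiv.addRight
        fun (k : Fin Ku) (i : Fin 2) (j : Fin d) => if θ k = i ∧ n = j.succ then (1 : Bool) else 0)
    have h2 := indepPair_map (PMF.uniformOfFintype
      (Library 2 (Fintype.card (Position Ku d m s)))) (PMF.uniformOfFintype (CoeffQuery Ku d)) id
      (fun r => maskedQuery θ r n)
    rw [h1, PMF.map_id] at h2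
    exact h2
  have hfac : ∀ θ, P.map (F ∘ G θ) = P.map F := fun θ => by rw [← PMF.map_comp, hlaw]
  exact (hfac θ).trans (hfac θ').symm

theorem blockScheme_shannonEntropy_answer_zero (θ : Demand 2 Ku) :
    shannonEntropy (blockScheme Ku d m s h).law ((blockScheme Ku d m s h).A θ 0) = 2 * m := by
  have h1 := shannonEntropy_of_shift (blockScheme Ku d m s h)
    (X := fun ω (i : Fin 2) (l : Fin m) =>
      combine (maskedQuery θ ω.2 0) (positionLibraryEquiv Ku d m s ω.1) i l) fun c =>
    ⟨libraryShift c, fun w r => funext fun i => funext fun l => combine_libraryShift c _ w i l⟩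
  have hlog := log_two_pos'.ne'
  trans Real.log (Fintype.card (Fin 2 → Fin m → Bool)) / Real.log 2
  · rw [← h1]
    refine shannonEntropy_congr _ fun ω ω' => ?_
    simp only [A, Q, blockScheme, combineAnswer, if_true, funext_iff, Prod.mk.injEq,
      Fin.forall_fin_two, forall_and]
  · simp only [Fintype.card_pi, Fintype.card_bool, Finset.prod_const, Finset.card_univ,
      Fintype.card_fin, Nat.cast_pow, Nat.cast_ofNat, Real.log_pow]
    field_simp

theorem blockScheme_shannonEntropy_answer_succ (θ : Demand 2 Ku) (n : Fin d) :
    shannonEntropy (blockScheme Ku d m s h).law ((blockScheme Ku d m s h).A θ n.succ) = m := by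
  have h1 := shannonEntropy_of_shift (blockScheme Ku d m s h)
    (X := fun ω (l : Fin m) =>
      combine (maskedQuery θ ω.2 n.succ) (positionLibraryEquiv Ku d m s ω.1) 0 l +
      combine (maskedQuery θ ω.2 n.succ) (positionLibraryEquiv Ku d m s ω.1) 1 l) fun c =>
    -- Shifting the uncached bits of message 0 alone already moves the sum arbitrarily.
    ⟨libraryShift fun i l => if i = 0 then c l else 0, fun w r => funext fun l => by
      refine (congrArg₂ (· + ·) (combine_libraryShift _ (maskedQuery θ r n.succ) w 0 l)
        (combine_libraryShift _ (maskedQuery θ r n.succ) w 1 l)).trans ?_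
      simp only [if_true, one_ne_zero, if_false, add_zero]
      exact add_right_comm _ _ _⟩
  have hlog := log_two_pos'.ne'
  trans Real.log (Fintype.card (Fin m → Bool)) / Real.log 2
  · rw [← h1]
    refine shannonEntropy_congr _ fun ω ω' => ?_
    simp only [A, Q, blockScheme, combineAnswer, if_neg (Fin.succ_ne_zero n), funext_iff,
      Prod.mk.injEq, and_true]
  · simp only [Fintype.card_pi, Fintype.card_bool, Finset.prod_const, Finset.card_univ,
      Fintype.card_fin, Nat.cast_pow, Nat.cast_ofNat, Real.log_pow]
    field_simp

theorem blockScheme_load (θ : Demand 2 Ku) :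
    (blockScheme Ku d m s h).load θ = m * (d + 2) / (m * (Ku * d + 1) + s) := by
  have hL : ((blockScheme Ku d m s h).L : ℝ) = m * (Ku * d + 1) + s := by
    simp [blockScheme]
  rw [load, hL, Fin.sum_univ_succ, blockScheme_shannonEntropy_answer_zero]
  simp only [blockScheme_shannonEntropy_answer_succ, Finset.sum_const, Finset.card_univ,
    Fintype.card_fin, nsmul_eq_mul]
  ring

end MuPIRScheme

/-- `M` is only required to bound the cache from above; this slack later lets a scheme for a
rational size serve a larger `M`. -/
theorem uncodedAchievable_blockScheme (Ku d m s : ℕ) (h : 0 < m * (Ku * d + 1) + s) {M : ℝ}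
    (hM : 2 * ((m : ℝ) * ((Ku - 1) * d) + s) ≤ M * (m * (Ku * d + 1) + s)) :
    UncodedAchievable 2 Ku (d + 1) M (m * (d + 2) / (m * (Ku * d + 1) + s)) := by
  have h' : 0 < Fintype.card (MuPIRScheme.Position Ku d m s) := by simpa using h
  refine ⟨MuPIRScheme.blockScheme Ku d m s h', MuPIRScheme.blockScheme_isUncoded h',
    MuPIRScheme.blockScheme_decodable h', MuPIRScheme.blockScheme_private h', fun u => ?_,
    MuPIRScheme.blockScheme_load h'⟩
  have hL : ((MuPIRScheme.blockScheme Ku d m s h').L : ℝ) = m * (Ku * d + 1) + s := by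
    simp [MuPIRScheme.blockScheme]
  have hKu : 1 ≤ Ku := by have := u.2; omega
  have hZ : ((MuPIRScheme.blockScheme Ku d m s h').cacheBits u : ℝ) =
      2 * (m * ((Ku - 1) * d) + s) := by
    simp [MuPIRScheme.blockScheme, Fintype.card_subtype_compl, Nat.cast_sub hKu]
  rw [hL, hZ]
  exact hM

/-! ### The lower convex envelope, and the optimality theorem -/

theorem memPoint_last {Ku : ℕ} (N : ℕ) (hKu : 2 ≤ Ku) :
    memPoint Ku N (Ku - 1) = 2 * ((Ku : ℝ) - 1) * ((N : ℝ) - 1) / (Ku * ((N : ℝ) - 1) + 1) := by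
  obtain ⟨k, rfl⟩ := Nat.exists_eq_add_of_le' hKu
  simp [memPoint, show k + 2 - 1 = k + 1 from rfl, add_sub_assoc]
  norm_num [add_assoc]

theorem two_sub_memPoint_last {Ku N : ℕ} (hKu : 2 ≤ Ku) (hN : 2 ≤ N) :
    2 - memPoint Ku N (Ku - 1) = 2 * N / (Ku * ((N : ℝ) - 1) + 1) := by
  rw [memPoint_last N hKu]
  have hN' : (2 : ℝ) ≤ N := by exact_mod_cast hN
  have : (Ku : ℝ) * ((N : ℝ) - 1) + 1 ≠ 0 := by
    have : (0 : ℝ) ≤ Ku * ((N : ℝ) - 1) := mul_nonneg (by positivity) (by linarith)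
    positivity
  field_simp
  ring

theorem loadPoint_last {Ku N : ℕ} (hKu : 2 ≤ Ku) (hN : 2 ≤ N) :
    loadPoint Ku N (Ku - 1) = ((N : ℝ) + 1) / (Ku * ((N : ℝ) - 1) + 1) := by
  unfold loadPoint
  rw [two_sub_memPoint_last hKu hN]
  have hN' : (2 : ℝ) ≤ N := by exact_mod_cast hN
  have h0 : (0 : ℝ) ≤ Ku * ((N : ℝ) - 1) := mul_nonneg (by positivity) (by linarith)
  have h1 : Ku.choose (Ku - 1) = Ku := by
    rw [Nat.choose_symm (by omega : 1 ≤ Ku), Nat.choose_one_right]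
  rw [h1, Nat.sub_add_cancel (by omega : 1 ≤ Ku), Nat.choose_self, Nat.cast_one, one_mul]
  -- The first entry of the minimum is the smaller because N + 1 ≤ 2N.
  refine min_eq_left (div_le_div_of_nonneg_right ?_ (by positivity))
  linarith

/-- The corner points lie above the single-user bound. -/
theorem singleUserBound_le_of_mem_cornerPoints {Ku N : ℕ} (hN : 2 ≤ N) {x : ℝ × ℝ}
    (hx : x ∈ cornerPoints Ku N) : (1 - x.1 / 2) * (1 + 1 / (N : ℝ)) ≤ x.2 := by
  have hN' : (2 : ℝ) ≤ N := by exact_mod_cast hN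
  have hN1 : 1 / (N : ℝ) ≤ 1 := by rw [div_le_one (by positivity)]; linarith
  rcases hx with ⟨t, ht1, ht2, rfl⟩ | rfl | rfl
  · obtain ⟨k, rfl⟩ : ∃ k, Ku = k + 1 := ⟨Ku - 1, by omega⟩
    obtain ⟨t, rfl⟩ : ∃ t', t = t' + 1 := ⟨t - 1, by omega⟩
    -- Pascal's rule expresses everything by three consecutive binomials a, b, c. Then 1 - M_t/2 has
    -- numerator bN + c, and the first entry of the minimum has numerator (b + c)(N + 1).
    have p1 : (((k + 1).choose (t + 1) : ℕ) : ℝ) = k.choose t + k.choose (t + 1) := by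
      rw [Nat.choose_succ_succ]; push_cast; ring
    have p2 : (((k + 1).choose (t + 1 + 1) : ℕ) : ℝ) = k.choose (t + 1) + k.choose (t + 1 + 1) := by
      rw [Nat.choose_succ_succ]; push_cast; ring
    have hpos : (0 : ℝ) < k.choose t := by
      exact_mod_cast Nat.choose_pos (by omega)
    have hb : (0 : ℝ) ≤ k.choose (t + 1) := by positivity
    have hc : (0 : ℝ) ≤ k.choose (t + 1 + 1) := by positivity
    simp only [memPoint, loadPoint, Nat.add_sub_cancel, p1, p2]
    set a : ℝ := (k.choose t : ℝ)
    set b : ℝ := (k.choose (t + 1) : ℝ)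
    set c : ℝ := (k.choose (t + 1 + 1) : ℝ)
    have hd : (0 : ℝ) < (N : ℝ) - 1 := by linarith
    have hD : 0 < (a + b) * ((N : ℝ) - 1) + (b + c) := by positivity
    have e : 1 - 2 * a * ((N : ℝ) - 1) / ((a + b) * ((N : ℝ) - 1) + (b + c)) / 2 =
        (b * N + c) / ((a + b) * ((N : ℝ) - 1) + (b + c)) := by
      field_simp
      ring
    have e' : 2 - 2 * a * ((N : ℝ) - 1) / ((a + b) * ((N : ℝ) - 1) + (b + c)) =
        2 * ((b * N + c) / ((a + b) * ((N : ℝ) - 1) + (b + c))) := by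
      rw [← e]; ring
    rw [e, e']
    have hq : 0 ≤ (b * N + c) / ((a + b) * ((N : ℝ) - 1) + (b + c)) := by positivity
    -- The entry 2 - M_t is handled by 1 + 1/N ≤ 2, the other one by c/N ≤ c.
    refine le_min ?_ (by nlinarith)
    rw [div_mul_eq_mul_div]
    refine div_le_div_of_nonneg_right ?_ hD.le
    have : (b * N + c) * (1 + 1 / (N : ℝ)) = (b + c / N) * (N + 1) := by field_simp
    rw [this]
    have hcN : c / N ≤ c := div_le_self hc (by linarith)
    exact mul_le_mul_of_nonneg_right (by linarith) (by linarith)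
  · norm_num
    simpa using (show 1 + 1 / (N : ℝ) ≤ 2 by linarith)
  · norm_num

/-- The region above the line is a half-plane, hence convex. -/
theorem singleUserBound_le_of_mem_convexHull {Ku N : ℕ} (hN : 2 ≤ N) {x : ℝ × ℝ}
    (hx : x ∈ convexHull ℝ (cornerPoints Ku N)) : (1 - x.1 / 2) * (1 + 1 / (N : ℝ)) ≤ x.2 := by
  refine convexHull_min (t := {x : ℝ × ℝ | (1 - x.1 / 2) * (1 + 1 / (N : ℝ)) ≤ x.2})
    (fun x => singleUserBound_le_of_mem_cornerPoints hN) ?_ hx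
  rintro ⟨x1, x2⟩ hx ⟨y1, y2⟩ hy a b ha hb hab
  simp only [Set.mem_ofPred_eq, Prod.smul_mk, Prod.mk_add_mk, smul_eq_mul] at hx hy ⊢
  calc (1 - (a * x1 + b * y1) / 2) * (1 + 1 / (N : ℝ))
      = a * ((1 - x1 / 2) * (1 + 1 / (N : ℝ))) + b * ((1 - y1 / 2) * (1 + 1 / (N : ℝ))) +
        (1 - (a + b)) * (1 + 1 / (N : ℝ)) := by ring
    _ ≤ a * x2 + b * y2 := by
      rw [hab, sub_self, zero_mul, add_zero]
      exact add_le_add (mul_le_mul_of_nonneg_left hx ha) (mul_le_mul_of_nonneg_left hy hb)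

theorem singleUserBound_mem_segment {Ku N : ℕ} (hKu : 2 ≤ Ku) (hN : 2 ≤ N) {M : ℝ}
    (h1 : memPoint Ku N (Ku - 1) ≤ M) (h2 : M ≤ 2) :
    (M, (1 - M / 2) * (1 + 1 / (N : ℝ))) ∈
      segment ℝ (memPoint Ku N (Ku - 1), loadPoint Ku N (Ku - 1)) ((2 : ℝ), (0 : ℝ)) := by
  have hN' : (2 : ℝ) ≤ N := by exact_mod_cast hN
  have h0 : (0 : ℝ) ≤ Ku * ((N : ℝ) - 1) := mul_nonneg (by positivity) (by linarith)
  have e1 := two_sub_memPoint_last hKu hN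
  have hpos : 0 < 2 - memPoint Ku N (Ku - 1) := by rw [e1]; positivity
  -- The corner point lies on the line through (2, 0) with slope -(1 + 1/N)/2.
  have e2 : loadPoint Ku N (Ku - 1) =
      (2 - memPoint Ku N (Ku - 1)) * ((1 + 1 / (N : ℝ)) / 2) := by
    rw [e1, loadPoint_last hKu hN]; field_simp
  refine ⟨(2 - M) / (2 - memPoint Ku N (Ku - 1)), 1 - (2 - M) / (2 - memPoint Ku N (Ku - 1)),
    div_nonneg (by linarith) hpos.le, sub_nonneg.2 ((div_le_one hpos).2 (by linarith)), by ring, ?_⟩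
  rw [e2]
  generalize memPoint Ku N (Ku - 1) = m at hpos ⊢
  simp only [Prod.smul_mk, Prod.mk_add_mk, smul_eq_mul, Prod.mk.injEq]
  constructor
  · field_simp
    ring
  · field_simp
    ring

theorem proposedLoad_eq {Ku N : ℕ} (hKu : 2 ≤ Ku) (hN : 2 ≤ N) {M : ℝ}
    (h1 : memPoint Ku N (Ku - 1) ≤ M) (h2 : M ≤ 2) :
    proposedLoad Ku N M = (1 - M / 2) * (1 + 1 / (N : ℝ)) := by
  refine IsLeast.csInf_eq ⟨?_, fun r hr => singleUserBound_le_of_mem_convexHull hN hr⟩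
  exact segment_subset_convexHull (x := (memPoint Ku N (Ku - 1), loadPoint Ku N (Ku - 1)))
    (y := ((2 : ℝ), (0 : ℝ))) (Or.inl ⟨Ku - 1, by omega, le_rfl, rfl⟩)
    (Or.inr (Or.inr rfl)) (singleUserBound_mem_segment hKu hN h1 h2)

/-- Memory sharing attains the single-user bound at rational memory sizes. -/
theorem uncodedAchievable_of_rat {Ku N : ℕ} (hKu : 2 ≤ Ku) (hN : 2 ≤ N) (x : ℚ) {M : ℝ}
    (h1 : memPoint Ku N (Ku - 1) ≤ x) (h2 : (x : ℝ) ≤ 2) (hM : (x : ℝ) ≤ M) :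
    UncodedAchievable 2 Ku N M ((1 - (x : ℝ) / 2) * (1 + 1 / (N : ℝ))) := by
  obtain ⟨d, rfl⟩ : ∃ d, N = d + 1 := ⟨N - 1, by omega⟩
  have e1 := two_sub_memPoint_last hKu hN
  have hy0 : 0 ≤ 1 - x / 2 := by
    have : x ≤ 2 := by exact_mod_cast h2
    linarith
  -- With 1 - x/2 = p/q, the scheme uses p blocks and messages of (d + 1)q bits: its load is p(d +
  -- 2)/((d + 1)q).
  obtain ⟨p, hp⟩ := Int.eq_ofNat_of_zero_le (Rat.num_nonneg.2 hy0)
  set q := (1 - x / 2).den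
  have hq : (0 : ℝ) < q := by exact_mod_cast (1 - x / 2).den_pos
  have hpq : (1 - (x : ℝ) / 2) = p / q := by
    have h := Rat.num_div_den (1 - x / 2)
    rw [hp] at h
    have h' := congrArg (fun z : ℚ => (z : ℝ)) h
    push_cast at h'
    exact h'.symm
  have hT : (0 : ℝ) < Ku * d + 1 := by positivity
  push_cast at e1
  rw [add_sub_cancel_right] at e1
  have hle : p * (Ku * d + 1) ≤ (d + 1) * q := by
    have h3 : (p : ℝ) / q ≤ (d + 1) / (Ku * d + 1) := by
      rw [← hpq]
      have : 2 * ((d : ℝ) + 1) / (Ku * d + 1) = 2 * ((d + 1) / (Ku * d + 1)) := by ring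
      linarith
    rw [div_le_div_iff₀ hq hT] at h3
    exact_mod_cast h3
  -- The bits outside the p blocks are cached by all users; they are nonnegative in number exactly
  -- because x is at least the last corner memory.
  obtain ⟨s, hs⟩ := Nat.exists_eq_add_of_le hle
  have hs' : ((d : ℝ) + 1) * q = p * (Ku * d + 1) + s := by exact_mod_cast hs
  have hx : (x : ℝ) = 2 * (1 - p / q) := by rw [← hpq]; ring
  have key := uncodedAchievable_blockScheme Ku d p s (M := M) (by
    rw [← hs]
    exact Nat.mul_pos (by omega) (1 - x / 2).den_pos) (by
    rw [← hs']
    refine le_trans (le_of_eq ?_) (mul_le_mul_of_nonneg_right hM (by positivity))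
    have : (s : ℝ) = (d + 1) * q - p * (Ku * d + 1) := by linarith
    rw [hx, this]
    field_simp
    ring)
  convert key using 1
  rw [← hs', hpq]
  push_cast
  field_simp
  ring

theorem isGLB_uncodedAchievable {Ku N : ℕ} (hKu : 2 ≤ Ku) (hN : 2 ≤ N) {M : ℝ}
    (h1 : memPoint Ku N (Ku - 1) ≤ M) (h2 : M ≤ 2) :
    IsGLB {R : ℝ | UncodedAchievable 2 Ku N M R} ((1 - M / 2) * (1 + 1 / (N : ℝ))) := by
  refine ⟨fun R ⟨S, _, hS⟩ => Achievable.le_load (by omega) (by omega) ⟨S, hS⟩, fun b hb => ?_⟩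
  have hN' : (0 : ℝ) < N := by exact_mod_cast (by omega : 0 < N)
  rcases h1.eq_or_lt with h | h
  · have hrat : ((2 * ((Ku : ℚ) - 1) * ((N : ℚ) - 1) / (Ku * ((N : ℚ) - 1) + 1) : ℚ) : ℝ) = M := by
      rw [← h, memPoint_last N hKu]
      push_cast
      rfl
    have := uncodedAchievable_of_rat hKu hN _ (h1.trans_eq hrat.symm) (hrat.trans_le h2) hrat.le
    rw [hrat] at this
    exact hb this
  · refine le_of_forall_pos_lt_add fun ε hε => ?_
    -- A rational size just below M fits in the cache and costs less than ε in load, the slope being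
    -- at most 1 in absolute value.
    obtain ⟨x, hx1, hx2⟩ := exists_rat_btwn (max_lt h (show M - ε < M by linarith))
    rw [max_lt_iff] at hx1
    refine (hb (uncodedAchievable_of_rat hKu hN x hx1.1.le (hx2.le.trans h2) hx2.le)).trans_lt ?_
    have hN1 : 1 / (N : ℝ) ≤ 1 := by
      rw [div_le_one hN']
      exact_mod_cast (by omega : 1 ≤ N)
    have hN0 : 0 < 1 / (N : ℝ) := by positivity
    nlinarith

theorem corollary3 (Ku N : ℕ) (hKu : 2 ≤ Ku) (hN : 2 ≤ N) :
    memPoint Ku N (Ku - 1) = 2 * ((Ku : ℝ) - 1) * ((N : ℝ) - 1) / (Ku * ((N : ℝ) - 1) + 1) ∧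
    loadPoint Ku N (Ku - 1) = ((N : ℝ) + 1) / (Ku * ((N : ℝ) - 1) + 1) ∧
    ∀ M : ℝ, memPoint Ku N (Ku - 1) ≤ M → M ≤ 2 →
      -- the load equals the single-user bound and is given by memory sharing
      proposedLoad Ku N M = (1 - M / 2) * (1 + 1 / (N : ℝ)) ∧
      (M, proposedLoad Ku N M) ∈
        segment ℝ (memPoint Ku N (Ku - 1), loadPoint Ku N (Ku - 1)) ((2 : ℝ), (0 : ℝ)) ∧
      -- it is optimal, with uncoded prefetching and also among all prefetching strategies
      IsGLB {R : ℝ | UncodedAchievable 2 Ku N M R} (proposedLoad Ku N M) ∧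
      IsGLB {R : ℝ | Achievable 2 Ku N M R} (proposedLoad Ku N M) ∧
      -- for rational memory sizes it is attained by a single scheme
      ((∃ q : ℚ, (q : ℝ) = M) → UncodedAchievable 2 Ku N M (proposedLoad Ku N M)) := by
  refine ⟨memPoint_last N hKu, loadPoint_last hKu hN, fun M h1 h2 => ?_⟩
  rw [proposedLoad_eq hKu hN h1 h2]
  have hglb := isGLB_uncodedAchievable hKu hN h1 h2
  -- For arbitrary prefetching the converse applies unchanged, and any lower bound also bounds the
  -- uncoded loads.
  refine ⟨rfl, singleUserBound_mem_segment hKu hN h1 h2, hglb,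
    ⟨fun R hR => hR.le_load (by omega) (by omega),
      fun b hb => hglb.2 fun R ⟨S, _, hS⟩ => hb ⟨S, hS⟩⟩, ?_⟩
  rintro ⟨x, rfl⟩
  exact uncodedAchievable_of_rat hKu hN x h1 h2 le_rfl
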